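/- Let $\overrightarrow{G}=([n],E)$ be a digraph without loops and with at most one edge from $u$ to $v$ for each ordered pair $(u,v)$ (edges $(u,v)$ and $(v,u)$ may both be present), and let $G$ be its underlying undirected simple graph. Let $$X_{\overrightarrow{G}}(\mathbf{x},t)=\sum_{\kappa}t^{\mathrm{asc}(\kappa)}\,x_{\kappa(1)}\cdots x_{\kappa(n)},$$ where $\kappa:[n]\to\{1,2,\dots\}$ runs over the proper colorings of $G$ and $\mathrm{asc}(\kappa)$ is the number of directed edges $(u,v)\in E$ with $\kappa(u)<\kappa(v)$. For $S\subseteq[n-1]$ let $$F_{n,S}(\mathbf{x})=\sum x_{i_1}x_{i_2}\cdots x_{i_n},$$ over all $i_1\ge i_2\ge\cdots\ge i_n\ge 1$ with $i_j>i_{j+1}$ for all $j\in S$, be Gessel's fundamental quasisymmetric function; the $F_{n,S}$ with $n\ge 0$ and $S\subseteq[n-1]$ form a basis of the $\mathbb{Q}[t]$-module $\mathrm{QSym}_{\mathbb{Q}}[t]=\mathrm{QSym}_{\mathbb{Q}[t]}$ of quasisymmetric functions, and $X_{\overrightarrow{G}}$ lies in this module. Let $\omega$ be the $\mathbb{Q}[t]$-linear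 involution of this module with $\omega F_{n,S}=F_{n,[n-1]\setminus S}$. For $\sigma=\sigma_1\cdots\sigma_n\in\mathfrak{S}_n$ let $\mathrm{inv}_{\overrightarrow{G}}(\sigma)$ be the number of $\overrightarrow{G}$-inversions of $\sigma$, that is, of directed edges $(u,v)\in E$ such that $v$ precedes $u$ in $\sigma$. The $(G,\sigma)$-rank $\mathrm{rank}_{(G,\sigma)}(x)$ of $x\in[n]$ is the length $k$ of the longest subword $\sigma_{i_1}\cdots\sigma_{i_k}$ of $\sigma$, $i_1<\cdots<i_k$, with $\sigma_{i_k}=x$ and $\{\sigma_{i_j},\sigma_{i_{j+1}}\}$ an edge of $G$ for all $1\le j<k$. Let $\mathrm{DES}_G(\sigma)$ be the set of $G$-descents of $\sigma$, that is, of all $i$ with $1\le i<n$ such that either $\mathrm{rank}_{(G,\sigma)}(\sigma_i)>\mathrm{rank}_{(G,\sigma)}(\sigma_{i+1})$, or $\mathrm{rank}_{(G,\sigma)}(\sigma_i)=\mathrm{rank}_{(G,\sigma)}(\sigma_{i+1})$ and $\sigma_i>\sigma_{i+1}$. Then $$\omega X_{\overrightarrow{G}}(\mathbf{x},t)=\sum_{\sigma\in\mathfrak{S}_n}F_{n,\mathrm{DES}_G(\sigma)}(\mathbf{x})\,t^{\mathrm{inv}_{\overrightarrow{G}}(\sigma)}.$$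 In particular, $\omega X_{\overrightarrow{G}}(\mathbf{x},t)$ is $F$-positive: its coefficients in the basis $(F_{m,S})$ are polynomials in $t$ with nonnegative coefficients. -/

import Mathlib

namespace ChromaticQSym

/-! ### Formal power series in `x₁, x₂, …`: generating series of words and colourings -/

/-- The exponent vector of the monomial `x_κ = ∏_v x_{κ(v)}`. -/
noncomputable def xMon {V : Type*} [Fintype V] (κ : V → ℕ+) : ℕ+ →₀ ℕ :=
  ∑ v, Finsupp.single (κ v) 1

open Classical in
/-- The finite set of all maps `κ : V → {1, 2, …}` with `x_κ = x^m`. -/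
noncomputable def withMon {V : Type*} [Fintype V] (m : ℕ+ →₀ ℕ) : Finset (V → ℕ+) :=
  (Fintype.piFinset fun _ => m.support).filter fun κ => xMon κ = m

/-- The formal power series `∑_κ wt(κ) x_κ`, over all maps `κ : V → {1, 2, …}`. -/
noncomputable def genSeries {R : Type*} [CommRing R] {V : Type*} [Fintype V]
    (wt : (V → ℕ+) → R) : MvPowerSeries ℕ+ R :=
  fun m => ∑ κ ∈ withMon m, wt κ

theorem mem_withMon {V : Type*} [Fintype V] (m : ℕ+ →₀ ℕ) (κ : V → ℕ+) :
    κ ∈ withMon m ↔ xMon κ = m := by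
  classical
  simp only [withMon, Finset.mem_filter, Fintype.mem_piFinset, and_iff_right_iff_imp]
  rintro rfl v
  rw [Finsupp.mem_support_iff, xMon, Finsupp.finsetSum_apply]
  intro h
  have := (Finset.sum_eq_zero_iff.mp h) v (Finset.mem_univ v)
  simp at this

theorem coeff_genSeries {R : Type*} [CommRing R] {V : Type*} [Fintype V]
    (wt : (V → ℕ+) → R) (m : ℕ+ →₀ ℕ) :
    MvPowerSeries.coeff m (genSeries wt) = ∑ κ ∈ withMon m, wt κ := rfl

theorem degree_xMon {V : Type*} [Fintype V] (κ : V → ℕ+) :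
    (xMon κ).degree = Fintype.card V := by
  simp [xMon]

theorem mem_support_xMon {V : Type*} [Fintype V] (κ : V → ℕ+) (v : V) :
    κ v ∈ (xMon κ).support := by
  classical
  have h := (mem_withMon (xMon κ) κ).2 rfl
  simp only [withMon, Finset.mem_filter, Fintype.mem_piFinset] at h
  exact h.1 v

theorem xMon_comp {V : Type*} [Fintype V] (φ : ℕ+ → ℕ+) (κ : V → ℕ+) :
    xMon (φ ∘ κ) = Finsupp.mapDomain φ (xMon κ) := by
  simp [xMon, Finsupp.mapDomain_finsetSum, Finsupp.mapDomain_single]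

/-! ### Quasisymmetric functions -/

/-- For all `i₁ < ⋯ < i_k` and `j₁ < ⋯ < j_k`, the monomials `x_{i₁}^{a₁} ⋯ x_{i_k}^{a_k}` and
`x_{j₁}^{a₁} ⋯ x_{j_k}^{a_k}` have the same coefficient. -/
def IsQuasisymmetric {R : Type*} [CommRing R] (f : MvPowerSeries ℕ+ R) : Prop :=
  ∀ (k : ℕ) (a : Fin k → ℕ) (i j : Fin k → ℕ+), StrictMono i → StrictMono j →
    MvPowerSeries.coeff (∑ l, Finsupp.single (i l) (a l)) f =
      MvPowerSeries.coeff (∑ l, Finsupp.single (j l) (a l)) f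

/-- The `R`-module of quasisymmetric functions in `x₁, x₂, …`: the power series of bounded degree
that are quasisymmetric. -/
def QSym (R : Type*) [CommRing R] : Submodule R (MvPowerSeries ℕ+ R) where
  carrier := {f | (∃ d : ℕ, ∀ m : ℕ+ →₀ ℕ, d < m.degree → MvPowerSeries.coeff m f = 0) ∧
    IsQuasisymmetric f}
  zero_mem' := ⟨⟨0, fun _ _ => rfl⟩, fun _ _ _ _ _ _ => rfl⟩
  add_mem' := by
    rintro f g ⟨⟨d, hd⟩, hf⟩ ⟨⟨e, he⟩, hg⟩
    refine ⟨⟨max d e, fun m hm => ?_⟩, fun k a i j hi hj => ?_⟩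
    · rw [map_add, hd m (lt_of_le_of_lt (le_max_left _ _) hm),
        he m (lt_of_le_of_lt (le_max_right _ _) hm), add_zero]
    · rw [map_add, map_add, hf k a i j hi hj, hg k a i j hi hj]
  smul_mem' := by
    rintro c f ⟨⟨d, hd⟩, hf⟩
    refine ⟨⟨d, fun m hm => ?_⟩, fun k a i j hi hj => ?_⟩
    · rw [map_smul, hd m hm, smul_zero]
    · rw [map_smul, map_smul, hf k a i j hi hj]

/-- A generating series whose weight only depends on the relative order of the values is
quasisymmetric. -/
theorem genSeries_mem {R : Type*} [CommRing R] {V : Type*} [Fintype V] (wt : (V → ℕ+) → R)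
    (hwt : ∀ κ κ' : V → ℕ+, (∀ u v, κ u < κ v ↔ κ' u < κ' v) → wt κ = wt κ') :
    genSeries wt ∈ QSym R := by
  classical
  refine ⟨⟨Fintype.card V, fun m hm => ?_⟩, fun k a i j hi hj => ?_⟩
  · rw [coeff_genSeries]
    refine Finset.sum_eq_zero fun κ hκ => ?_
    rw [mem_withMon] at hκ
    rw [← hκ, degree_xMon] at hm
    exact absurd hm (lt_irrefl _)
  · have hmap : ∀ i j : Fin k → ℕ+, StrictMono i →
        Finsupp.mapDomain (Function.extend i j id) (∑ l, Finsupp.single (i l) (a l)) =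
          ∑ l, Finsupp.single (j l) (a l) := by
      intro i j hi
      rw [Finsupp.mapDomain_finsetSum]
      refine Finset.sum_congr rfl fun l _ => ?_
      rw [Finsupp.mapDomain_single, hi.injective.extend_apply]
    have hrange : ∀ (i : Fin k → ℕ+) (κ : V → ℕ+),
        κ ∈ withMon (∑ l, Finsupp.single (i l) (a l)) → ∀ v, ∃ l, i l = κ v := by
      intro i κ hκ v
      rw [mem_withMon] at hκ
      have h := mem_support_xMon κ v
      rw [hκ, Finsupp.mem_support_iff, Finsupp.finsetSum_apply] at h
      obtain ⟨l, _, hl⟩ := Finset.exists_ne_zero_of_sum_ne_zero h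
      exact ⟨l, by by_contra hne; exact hl (Finsupp.single_eq_of_ne (Ne.symm hne))⟩
    have hmem : ∀ i j : Fin k → ℕ+, StrictMono i → ∀ κ : V → ℕ+,
        κ ∈ withMon (∑ l, Finsupp.single (i l) (a l)) →
        Function.extend i j id ∘ κ ∈ withMon (∑ l, Finsupp.single (j l) (a l)) := by
      intro i j hi κ hκ
      rw [mem_withMon] at hκ ⊢
      rw [xMon_comp, hκ, hmap i j hi]
    have hinv : ∀ i j : Fin k → ℕ+, StrictMono i → StrictMono j → ∀ κ : V → ℕ+,
        κ ∈ withMon (∑ l, Finsupp.single (i l) (a l)) →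
        Function.extend j i id ∘ (Function.extend i j id ∘ κ) = κ := by
      intro i j hi hj κ hκ
      funext v
      obtain ⟨l, hl⟩ := hrange i κ hκ v
      simp only [Function.comp_apply, ← hl, hi.injective.extend_apply,
        hj.injective.extend_apply]
    rw [coeff_genSeries, coeff_genSeries]
    refine Finset.sum_nbij' (fun κ => Function.extend i j id ∘ κ)
      (fun κ => Function.extend j i id ∘ κ) (hmem i j hi) (hmem j i hj)
      (hinv i j hi hj) (hinv j i hj hi) fun κ hκ => hwt _ _ fun u v => ?_
    obtain ⟨l, hl⟩ := hrange i κ hκ u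
    obtain ⟨l', hl'⟩ := hrange i κ hκ v
    simp only [Function.comp_apply, ← hl, ← hl', hi.injective.extend_apply, hi.lt_iff_lt,
      hj.lt_iff_lt]

/-! ### Gessel's fundamental quasisymmetric functions

A subset of `[n-1]` is a `Finset (Fin (n - 1))`; the element `i` of `Fin (n - 1)` stands for
`i + 1 ∈ [n-1]`, and `[n]` is `Fin n` in the same way. -/

/-- The `i`-th of the positions `1, …, n-1` of a word of length `n`. -/
def here {n : ℕ} (i : Fin (n - 1)) : Fin n := ⟨i, by omega⟩

/-- The position that follows `here i`. -/
def next {n : ℕ} (i : Fin (n - 1)) : Fin n := ⟨i + 1, by omega⟩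

/-- The words `w₁ ≥ w₂ ≥ ⋯ ≥ w_n` with `w_i > w_{i+1}` for all `i ∈ S`. -/
def IsFWord (n : ℕ) (S : Finset (Fin (n - 1))) (w : Fin n → ℕ+) : Prop :=
  Antitone w ∧ ∀ i ∈ S, w (next i) < w (here i)

open Classical in
/-- Gessel's `F_{n,S} = ∑ x_{w₁} ⋯ x_{w_n}`, over all `w₁ ≥ w₂ ≥ ⋯ ≥ w_n ≥ 1` with
`w_i > w_{i+1}` for all `i ∈ S`. -/
noncomputable def fundamental (R : Type*) [CommRing R] (n : ℕ) (S : Finset (Fin (n - 1))) :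
    QSym R :=
  ⟨genSeries fun w : Fin n → ℕ+ => if IsFWord n S w then 1 else 0, genSeries_mem _ (by
    intro κ κ' h
    have h' : ∀ u v, κ u ≤ κ v ↔ κ' u ≤ κ' v := fun u v => by
      rw [← not_lt, ← not_lt, h]
    have hiff : IsFWord n S κ ↔ IsFWord n S κ' := by simp only [IsFWord, Antitone, h, h']
    simp only [hiff])⟩

/-! ### The fundamental quasisymmetric functions form a basis -/

/-- The smallest decreasing word with strict descents exactly at `S`. -/
def canon (n : ℕ) (S : Finset (Fin (n - 1))) (j : Fin n) : ℕ+ :=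
  ⟨(S.filter fun i : Fin (n - 1) => (j : ℕ) ≤ i).card + 1, Nat.succ_pos _⟩

theorem canon_antitone (n : ℕ) (S : Finset (Fin (n - 1))) : Antitone (canon n S) := by
  intro j k hjk
  rw [← PNat.coe_le_coe]
  simp only [canon, PNat.mk_coe, add_le_add_iff_right]
  refine Finset.card_le_card fun i hi => ?_
  rw [Finset.mem_filter] at hi ⊢
  exact ⟨hi.1, le_trans (by exact_mod_cast hjk) hi.2⟩

theorem canon_lt_iff (n : ℕ) (S : Finset (Fin (n - 1))) (i : Fin (n - 1)) :
    canon n S (next i) < canon n S (here i) ↔ i ∈ S := by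
  rw [← PNat.coe_lt_coe]
  have h1 : ((here i : Fin n) : ℕ) = i := rfl
  have h2 : ((next i : Fin n) : ℕ) = i + 1 := rfl
  simp only [canon, PNat.mk_coe, add_lt_add_iff_right]
  constructor
  · intro h
    by_contra hi
    refine absurd h (not_lt.2 (Finset.card_le_card fun j hj => ?_))
    rw [Finset.mem_filter] at hj ⊢
    refine ⟨hj.1, ?_⟩
    have hne : (i : ℕ) ≠ j := fun he => hi (Fin.ext he ▸ hj.1)
    omega
  · intro hi
    refine Finset.card_lt_card ((Finset.ssubset_iff_of_subset ?_).2 ⟨i, ?_, ?_⟩)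
    · intro j hj
      rw [Finset.mem_filter] at hj ⊢
      exact ⟨hj.1, by omega⟩
    · simpa [h1] using hi
    · simp [h2]

theorem isFWord_canon_iff (n : ℕ) (S T : Finset (Fin (n - 1))) :
    IsFWord n S (canon n T) ↔ S ⊆ T := by
  simp only [IsFWord, canon_antitone, true_and, canon_lt_iff]
  rfl

theorem xMon_eq_toFinsupp {n : ℕ} (w : Fin n → ℕ+) :
    xMon w = Multiset.toFinsupp (List.ofFn w : Multiset ℕ+) := by
  ext a
  rw [Multiset.toFinsupp_apply, Multiset.coe_count, xMon, Finsupp.finsetSum_apply]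
  induction n with
  | zero => simp
  | succ n ih =>
    rw [Fin.sum_univ_succ, List.ofFn_succ, List.count_cons, ih, add_comm]
    simp [Finsupp.single_apply]

theorem antitone_ext {n : ℕ} {w w' : Fin n → ℕ+} (hw : Antitone w) (hw' : Antitone w')
    (h : xMon w = xMon w') : w = w' := by
  rw [xMon_eq_toFinsupp, xMon_eq_toFinsupp] at h
  have hp : (List.ofFn w).Perm (List.ofFn w') :=
    Multiset.coe_eq_coe.1 (Multiset.toFinsupp.injective h)
  exact List.ofFn_injective (hp.eq_of_sortedGE hw.sortedGE_ofFn hw'.sortedGE_ofFn)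

theorem exists_antitone (m : ℕ+ →₀ ℕ) :
    ∃ (n : ℕ) (w : Fin n → ℕ+), Antitone w ∧ xMon w = m := by
  refine ⟨_, ((Finsupp.toMultiset m).sort (· ≥ ·)).get, ?_, ?_⟩
  · rw [← List.sortedGE_ofFn_iff, List.ofFn_get]
    exact ((Finsupp.toMultiset m).pairwise_sort (· ≥ ·)).sortedGE
  · rw [xMon_eq_toFinsupp, List.ofFn_get, Multiset.sort_eq, Finsupp.toMultiset_toFinsupp]

theorem antitone_lt_iff {n : ℕ} {w : Fin n → ℕ+} (hw : Antitone w) (u v : Fin n) :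
    w u < w v ↔ ∃ i : Fin (n - 1), v ≤ here i ∧ next i ≤ u ∧ w (next i) < w (here i) := by
  constructor
  · intro h
    by_contra! hc
    have key : ∀ (k : ℕ) (hk : v.1 + k < n), v.1 + k ≤ u.1 → w v ≤ w ⟨v.1 + k, hk⟩ := by
      intro k
      induction k with
      | zero => intro _ _; exact le_refl _
      | succ k ih =>
        intro hk hu
        refine (ih (by omega) (by omega)).trans ?_
        exact hc ⟨v.1 + k, by omega⟩ (by simp [here, Fin.le_def])
          (by simp only [next, Fin.le_def]; omega)
    have hvu : v.1 ≤ u.1 := by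
      by_contra hlt
      exact absurd (hw (show u ≤ v from by rw [Fin.le_def]; omega)) (not_le.2 h)
    have h1 := key (u.1 - v.1) (by omega) (by omega)
    have h2 : (⟨v.1 + (u.1 - v.1), by omega⟩ : Fin n) = u := Fin.ext (by simp; omega)
    rw [h2] at h1
    exact absurd h (not_lt.2 h1)
  · rintro ⟨i, h1, h2, h3⟩
    exact (hw h2).trans_lt (h3.trans_le (hw h1))

theorem coeff_eq_of_desc {R : Type*} [CommRing R] {f : MvPowerSeries ℕ+ R}
    (hf : IsQuasisymmetric f) {n : ℕ} {w w' : Fin n → ℕ+} (hw : Antitone w) (hw' : Antitone w')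
    (h : ∀ i, w (next i) < w (here i) ↔ w' (next i) < w' (here i)) :
    MvPowerSeries.coeff (xMon w) f = MvPowerSeries.coeff (xMon w') f := by
  classical
  have hlt : ∀ u v, w u < w v ↔ w' u < w' v := fun u v => by
    rw [antitone_lt_iff hw, antitone_lt_iff hw']
    simp only [h]
  have heq : ∀ u v, w u = w v → w' u = w' v := fun u v he =>
    le_antisymm (not_lt.1 fun hc => by rw [← hlt, he] at hc; exact lt_irrefl _ hc)
      (not_lt.1 fun hc => by rw [← hlt, he] at hc; exact lt_irrefl _ hc)
  set s := (xMon w).support with hs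
  let i : Fin s.card → ℕ+ := s.orderEmbOfFin rfl
  have hi : StrictMono i := (s.orderEmbOfFin rfl).strictMono
  have hir : ∀ l, ∃ v, w v = i l := by
    intro l
    have h1 : i l ∈ s := s.orderEmbOfFin_mem rfl l
    rw [hs, Finsupp.mem_support_iff, xMon, Finsupp.finsetSum_apply] at h1
    obtain ⟨v, _, hv⟩ := Finset.exists_ne_zero_of_sum_ne_zero h1
    exact ⟨v, by by_contra hne; exact hv (Finsupp.single_eq_of_ne (Ne.symm hne))⟩
  choose p hp using hir
  have hj : StrictMono fun l => w' (p l) := by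
    intro a b hab
    have h1 := hi hab
    rw [← hp a, ← hp b, hlt] at h1
    exact h1
  have e1 : xMon w = ∑ l, Finsupp.single (i l) (xMon w (i l)) := by
    conv_lhs => rw [← Finsupp.sum_single (xMon w), Finsupp.sum, ← hs,
      ← Finset.image_orderEmbOfFin_univ s rfl, Finset.sum_image fun _ _ _ _ h => hi.injective h]
  have e2 : xMon w' = ∑ l, Finsupp.single (w' (p l)) (xMon w (i l)) := by
    have hφ : w' = Function.extend i (fun l => w' (p l)) id ∘ w := by
      funext v
      have hv : w v ∈ Set.range i := by
        have h1 : w v ∈ s := mem_support_xMon w v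
        rwa [← Finset.mem_coe, ← Finset.range_orderEmbOfFin s rfl] at h1
      obtain ⟨l, hl⟩ := hv
      rw [Function.comp_apply, ← hl, hi.injective.extend_apply]
      exact heq _ _ (by rw [hp, hl])
    conv_lhs => rw [hφ, xMon_comp, e1, Finsupp.mapDomain_finsetSum]
    refine Finset.sum_congr rfl fun l _ => ?_
    rw [Finsupp.mapDomain_single, hi.injective.extend_apply]
  rw [e1, e2]
  exact hf _ _ _ _ hi hj

theorem QSym_ext {R : Type*} [CommRing R] {f g : QSym R}
    (h : ∀ n S, MvPowerSeries.coeff (xMon (canon n S)) f.1 =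
      MvPowerSeries.coeff (xMon (canon n S)) g.1) : f = g := by
  classical
  refine Subtype.ext (MvPowerSeries.ext fun m => ?_)
  obtain ⟨n, w, hw, rfl⟩ := exists_antitone m
  have hd : ∀ i, w (next i) < w (here i) ↔
      canon n (Finset.univ.filter fun i => w (next i) < w (here i)) (next i) <
        canon n (Finset.univ.filter fun i => w (next i) < w (here i)) (here i) := by
    intro i
    rw [canon_lt_iff]
    simp
  rw [coeff_eq_of_desc f.2.2 hw (canon_antitone _ _) hd,
    coeff_eq_of_desc g.2.2 hw (canon_antitone _ _) hd, h]

theorem coeff_fundamental_of_ne {R : Type*} [CommRing R] {n : ℕ} (S : Finset (Fin (n - 1)))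
    {m : ℕ+ →₀ ℕ} (hm : m.degree ≠ n) :
    MvPowerSeries.coeff m (fundamental R n S).1 = 0 := by
  classical
  refine Finset.sum_eq_zero fun κ hκ => absurd ?_ hm
  rw [mem_withMon] at hκ
  rw [← hκ, degree_xMon, Fintype.card_fin]

open Classical in
theorem coeff_fundamental_canon (R : Type*) [CommRing R] (n : ℕ) (S T : Finset (Fin (n - 1))) :
    MvPowerSeries.coeff (xMon (canon n T)) (fundamental R n S).1 = if S ⊆ T then 1 else 0 := by
  refine (Finset.sum_eq_single (canon n T) ?_ ?_).trans ?_
  · intro κ hκ hne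
    rw [mem_withMon] at hκ
    exact if_neg fun hF => hne (antitone_ext hF.1 (canon_antitone _ _) hκ)
  · intro hc
    exact absurd ((mem_withMon _ _).2 rfl) hc
  · simp only [isFWord_canon_iff]

theorem linearIndependent_fundamental (R : Type*) [CommRing R] :
    LinearIndependent R fun p : Σ n : ℕ, Finset (Fin (n - 1)) => fundamental R p.1 p.2 := by
  classical
  rw [linearIndependent_iff]
  intro l hl
  have key : ∀ (k n : ℕ) (T : Finset (Fin (n - 1))), T.card = k → l ⟨n, T⟩ = 0 := by
    intro k
    induction k using Nat.strong_induction_on with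
    | _ k ih =>
      intro n T hT
      have h0 : MvPowerSeries.coeff (xMon (canon n T))
          ((QSym R).subtype (Finsupp.linearCombination R
            (fun p : Σ n : ℕ, Finset (Fin (n - 1)) => fundamental R p.1 p.2) l)) = 0 := by
        rw [hl, map_zero, map_zero]
      rw [Finsupp.linearCombination_apply, Finsupp.sum, map_sum, map_sum,
        Finset.sum_eq_single ⟨n, T⟩] at h0
      · simpa [coeff_fundamental_canon] using h0
      · rintro ⟨n', S⟩ _ hne
        rw [map_smul, map_smul, Submodule.subtype_apply]
        by_cases hn : n = n'
        · subst hn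
          rw [coeff_fundamental_canon]
          split_ifs with hST
          · have hss : S ⊂ T := lt_of_le_of_ne hST fun he => hne (by rw [he])
            rw [ih S.card (hT ▸ Finset.card_lt_card hss) n S rfl, zero_smul]
          · rw [smul_zero]
        · rw [coeff_fundamental_of_ne, smul_zero]
          rw [degree_xMon, Fintype.card_fin]
          exact hn
      · intro hn
        rw [Finsupp.notMem_support_iff.1 hn, zero_smul, map_zero, map_zero]
  ext ⟨n, T⟩
  exact key _ n T rfl

theorem exists_sum_powerset {R : Type*} [CommRing R] {α : Type*} [DecidableEq α]
    (c : Finset α → R) : ∃ a : Finset α → R, ∀ T, ∑ S ∈ T.powerset, a S = c T := by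
  refine ⟨Finset.strongInduction fun T ih =>
    c T - ∑ S ∈ T.ssubsets.attach, ih S.1 (Finset.mem_ssubsets.1 S.2), fun T => ?_⟩
  rw [← Finset.insert_erase (Finset.mem_powerset_self T),
    Finset.sum_insert (Finset.notMem_erase _ _), Finset.strongInduction_eq,
    Finset.sum_attach T.ssubsets fun S => Finset.strongInduction _ S]
  exact sub_add_cancel _ _

theorem span_fundamental (R : Type*) [CommRing R] :
    ⊤ ≤ Submodule.span R (Set.range
      fun p : Σ n : ℕ, Finset (Fin (n - 1)) => fundamental R p.1 p.2) := by
  classical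
  rintro f -
  obtain ⟨d, hd⟩ := f.2.1
  choose a ha using fun n : ℕ => exists_sum_powerset
    fun T : Finset (Fin (n - 1)) => MvPowerSeries.coeff (xMon (canon n T)) f.1
  have hf : f = ∑ n ∈ Finset.range (d + 1), ∑ S : Finset (Fin (n - 1)),
      a n S • fundamental R n S := by
    refine QSym_ext fun n T => ?_
    change _ = MvPowerSeries.coeff (xMon (canon n T)) ((QSym R).subtype _)
    simp only [map_sum, map_smul, Submodule.subtype_apply]
    have hn : ∀ n' ∈ Finset.range (d + 1), n' ≠ n → ∑ S : Finset (Fin (n' - 1)),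
        a n' S • MvPowerSeries.coeff (xMon (canon n T)) (fundamental R n' S).1 = 0 := by
      intro n' _ hne
      refine Finset.sum_eq_zero fun S _ => ?_
      rw [coeff_fundamental_of_ne, smul_zero]
      rw [degree_xMon, Fintype.card_fin]
      exact hne.symm
    by_cases hnd : n ∈ Finset.range (d + 1)
    · rw [Finset.sum_eq_single_of_mem n hnd hn, ← ha n T]
      simp only [coeff_fundamental_canon, smul_eq_mul, mul_ite, mul_one, mul_zero]
      rw [← Finset.sum_filter]
      exact Finset.sum_congr (by ext; simp) fun _ _ => rfl
    · rw [hd, Finset.sum_eq_zero fun n' h' => hn n' h' fun he => hnd (he ▸ h')]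
      rw [degree_xMon, Fintype.card_fin]
      simpa using hnd
  rw [hf]
  exact Submodule.sum_mem _ fun n _ => Submodule.sum_mem _ fun S _ =>
    Submodule.smul_mem _ _ (Submodule.subset_span ⟨⟨n, S⟩, rfl⟩)

/-- The basis `(F_{n,S})`, `n ≥ 0`, `S ⊆ [n-1]`, of the module of quasisymmetric functions. -/
noncomputable def fundamentalBasis (R : Type*) [CommRing R] :
    Module.Basis (Σ n : ℕ, Finset (Fin (n - 1))) R (QSym R) :=
  Module.Basis.mk (linearIndependent_fundamental R) (span_fundamental R)

theorem fundamentalBasis_apply (R : Type*) [CommRing R] (n : ℕ) (S : Finset (Fin (n - 1))) :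
    fundamentalBasis R ⟨n, S⟩ = fundamental R n S :=
  Module.Basis.mk_apply _ _ _

/-! ### The involution `ω` and `F`-positivity -/

/-- The involution `ω` of the quasisymmetric functions: the `R`-linear map with
`ω F_{n,S} = F_{n,[n-1]∖S}`. It extends the involution of the symmetric functions that sends
`h_n = F_{n,∅}` to `e_n = F_{n,[n-1]}`. -/
noncomputable def omega (R : Type*) [CommRing R] : QSym R →ₗ[R] QSym R :=
  (fundamentalBasis R).constr R fun p => fundamental R p.1 p.2ᶜ

theorem omega_fundamental (R : Type*) [CommRing R] (n : ℕ) (S : Finset (Fin (n - 1))) :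
    omega R (fundamental R n S) = fundamental R n Sᶜ := by
  rw [omega, ← fundamentalBasis_apply, Module.Basis.constr_basis]

open scoped Polynomial in
/-- All coefficients in the expansion in the basis `(F_{n,S})` are polynomials in `t` with
nonnegative coefficients. -/
def IsFPositive (f : QSym ℚ[X]) : Prop :=
  ∀ (p : Σ n : ℕ, Finset (Fin (n - 1))) (k : ℕ),
    0 ≤ ((fundamentalBasis ℚ[X]).repr f p).coeff k

/-! ### The chromatic quasisymmetric function of a digraph -/

open Classical in
/-- The number of ascents of `κ`: directed edges `(u, v)` with `κ(u) < κ(v)`. -/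
noncomputable def asc {V : Type*} [Fintype V] (D : Digraph V) (κ : V → ℕ+) : ℕ :=
  (Finset.univ.filter fun e : V × V => D.Adj e.1 e.2 ∧ κ e.1 < κ e.2).card

/-- Proper colourings of a digraph are those of its underlying undirected graph. -/
def IsProper {V : Type*} (D : Digraph V) (κ : V → ℕ+) : Prop :=
  ∀ u v, D.toSimpleGraphInclusive.Adj u v → κ u ≠ κ v

open scoped Polynomial in
open Classical in
/-- `X_D(x, t) = ∑_κ t^{asc(κ)} x_κ`, over all proper colourings `κ : V → {1, 2, …}` of `D`, as a
quasisymmetric function with coefficients in `ℚ[t]`. -/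
noncomputable def chromatic {V : Type*} [Fintype V] (D : Digraph V) : QSym ℚ[X] :=
  ⟨genSeries fun κ : V → ℕ+ => if IsProper D κ then Polynomial.X ^ asc D κ else 0,
    genSeries_mem _ (by
      intro κ κ' h
      have h' : ∀ u v, κ u = κ v ↔ κ' u = κ' v := fun u v => by
        rw [← not_iff_not, ← Ne, ← Ne, lt_or_lt_iff_ne.symm, lt_or_lt_iff_ne.symm, h, h]
      have hp : IsProper D κ ↔ IsProper D κ' := by simp only [IsProper, ne_eq, h']
      have ha : asc D κ = asc D κ' := by simp only [asc, h]
      simp only [hp, ha])⟩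

/-! ### Permutation statistics

A permutation `σ` of `[n]` is the word `σ₁ σ₂ ⋯ σ_n` with `σ_i = σ i`. -/

open Classical in
/-- The number of `D`-inversions of `σ`: directed edges `(u, v)` with `σ⁻¹(u) > σ⁻¹(v)`. -/
noncomputable def inv {n : ℕ} (D : Digraph (Fin n)) (σ : Equiv.Perm (Fin n)) : ℕ :=
  (Finset.univ.filter fun e : Fin n × Fin n =>
    D.Adj e.1 e.2 ∧ σ.symm e.2 < σ.symm e.1).card

/-- The `(G, σ)`-rank of `x`: the largest length `k + 1` of a subword `σ_{i_0} ⋯ σ_{i_k}` of `σ`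
that ends in `x` and whose consecutive letters are adjacent in `G`. -/
noncomputable def rank {n : ℕ} (G : SimpleGraph (Fin n)) (σ : Equiv.Perm (Fin n))
    (x : Fin n) : ℕ :=
  sSup {L | ∃ (k : ℕ) (i : Fin (k + 1) → Fin n), L = k + 1 ∧ StrictMono i ∧
    σ (i (Fin.last k)) = x ∧ ∀ j : Fin k, G.Adj (σ (i j.castSucc)) (σ (i j.succ))}

open Classical in
/-- The set of `G`-descents of `σ`. -/
noncomputable def DES {n : ℕ} (G : SimpleGraph (Fin n)) (σ : Equiv.Perm (Fin n)) :
    Finset (Fin (n - 1)) :=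
  Finset.univ.filter fun i =>
    rank G σ (σ (next i)) < rank G σ (σ (here i)) ∨
      (rank G σ (σ (here i)) = rank G σ (σ (next i)) ∧ σ (next i) < σ (here i))

end ChromaticQSym

namespace ChromaticQSym

/-! ### Sorting the vertices of a coloured graph -/

/-! Since `ω` complements descent sets, it suffices to expand the chromatic function itself as the
sum of `t^inv(σ) F_{n, DES(σ)ᶜ}` over all `σ`. Reading a word of the `σ`-th summand as `κ ∘ σ` turns
this into a statement about each single map `κ`: if `κ` is proper, exactly one `σ` makes `κ ∘ σ` an
admissible word, and then `asc κ = inv σ`; if `κ` is not proper, no `σ` does.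

Admissibility says that `σ` lists the vertices in strictly decreasing order of the key (colour,
rank, label) (`isFWord_compl_DES_iff`). The rank depends on `σ`, so this does not yet determine `σ`.
For proper `κ`, however, the rank equals `colorRank`, which depends on `κ` alone
(`rank_eq_colorRank`), so `σ` has to be the permutation sorting a fixed injective key. Conversely,
ranks increase along edges read from left to right (`rank_lt_rank`), so two adjacent vertices of
equal colour would contradict the decrease of the key (`isProper_of_isFWord`). -/

/-- The vertices `x` compared by the colour `κ x`, then by `r x`, then by `x` itself. -/
def sortKey {n : ℕ} (κ : Fin n → ℕ+) (r : Fin n → ℕ) (x : Fin n) : ℕ+ ×ₗ ℕ ×ₗ Fin n :=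
  toLex (κ x, toLex (r x, x))

theorem sortKey_lt_iff {n : ℕ} {κ : Fin n → ℕ+} {r : Fin n → ℕ} {x y : Fin n} :
    sortKey κ r x < sortKey κ r y ↔
      κ x < κ y ∨ κ x = κ y ∧ (r x < r y ∨ r x = r y ∧ x < y) := by
  simp [sortKey, Prod.Lex.toLex_lt_toLex]

theorem sortKey_injective {n : ℕ} (κ : Fin n → ℕ+) (r : Fin n → ℕ) :
    Function.Injective (sortKey κ r) := by
  intro x y h
  exact congrArg (fun p : ℕ+ ×ₗ ℕ ×ₗ Fin n => (ofLex (ofLex p).2).2) h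

theorem sortKey_le {n : ℕ} {κ : Fin n → ℕ+} {r : Fin n → ℕ} {x y : Fin n}
    (h : sortKey κ r x ≤ sortKey κ r y) : κ x ≤ κ y := by
  rcases h.lt_or_eq with h | h
  · rcases sortKey_lt_iff.1 h with h | h
    · exact h.le
    · exact h.1.le
  · rw [sortKey_injective κ r h]

theorem strictAnti_iff_next_lt_here {n : ℕ} {α : Type*} [Preorder α] {f : Fin n → α} :
    StrictAnti f ↔ ∀ i : Fin (n - 1), f (next i) < f (here i) := by
  cases n with
  | zero => exact ⟨fun _ i => i.elim0, fun _ i => i.elim0⟩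
  -- For words of length `n + 1`, `here i` and `next i` unfold to `i.castSucc` and `i.succ`.
  | succ n => exact Fin.strictAnti_iff_succ_lt

/-- A `G`-descent is exactly a position where the tie-breaker (rank, label) drops. There a weak drop
in colour suffices; at every other position the colour itself must drop. -/
theorem isFWord_compl_DES_iff {n : ℕ} (G : SimpleGraph (Fin n)) (κ : Fin n → ℕ+)
    (σ : Equiv.Perm (Fin n)) :
    IsFWord n (DES G σ)ᶜ (κ ∘ σ) ↔ StrictAnti (sortKey κ (rank G σ) ∘ σ) := by
  rw [strictAnti_iff_next_lt_here]
  constructor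
  · rintro ⟨hanti, hlt⟩ i
    rw [Function.comp_apply, Function.comp_apply, sortKey_lt_iff]
    by_cases hi : i ∈ DES G σ
    · have hle : κ (σ (next i)) ≤ κ (σ (here i)) :=
        hanti (show here i ≤ next i by simp [here, next, Fin.le_def])
      rcases hle.lt_or_eq with h | h
      · exact Or.inl h
      · refine Or.inr ⟨h, ?_⟩
        simp only [DES, Finset.mem_filter, Finset.mem_univ, true_and] at hi
        exact hi.imp id fun h => ⟨h.1.symm, h.2⟩
    · exact Or.inl (hlt i (Finset.mem_compl.2 hi))
  · intro h
    refine ⟨fun a b hab => sortKey_le (x := σ b) (y := σ a)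
      ((strictAnti_iff_next_lt_here.2 h).antitone hab), fun i hi => ?_⟩
    have hi' := h i
    rw [Function.comp_apply, Function.comp_apply, sortKey_lt_iff] at hi'
    refine hi'.resolve_right fun hc => ?_
    simp only [DES, Finset.mem_compl, Finset.mem_filter, Finset.mem_univ, true_and] at hi
    exact hi (hc.2.imp id fun h => ⟨h.1.symm, h.2⟩)

theorem existsUnique_strictAnti_comp {n : ℕ} {α : Type*} [LinearOrder α] {f : Fin n → α}
    (hf : Function.Injective f) : ∃! σ : Equiv.Perm (Fin n), StrictAnti (f ∘ σ) := by
  -- `Tuple.sort` sorts increasingly, hence the passage to the dual order.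
  refine ⟨Tuple.sort (OrderDual.toDual ∘ f), ?_, fun τ hτ => ?_⟩
  · exact Antitone.strictAnti_of_injective
      (Tuple.monotone_sort (OrderDual.toDual ∘ f)) (hf.comp (Equiv.injective _))
  · have h : (OrderDual.toDual ∘ f) ∘ τ = (OrderDual.toDual ∘ f) ∘ Tuple.sort _ :=
      Tuple.unique_monotone (f := OrderDual.toDual ∘ f) hτ.antitone (Tuple.monotone_sort _)
    exact Equiv.ext fun x => hf (congrFun h x)

/-! ### Ranks -/

/-- The letter `σ b` can be appended to a longest subword ending in `σ a`. -/
theorem rank_lt_rank {n : ℕ} {G : SimpleGraph (Fin n)} {σ : Equiv.Perm (Fin n)} {a b : Fin n}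
    (hab : a < b) (hadj : G.Adj (σ a) (σ b)) : rank G σ (σ a) < rank G σ (σ b) := by
  -- Subwords have at most `n` letters. Boundedness makes the supremum a true maximum rather than
  -- the default value `0`.
  have hbdd : ∀ x, BddAbove {L | ∃ (k : ℕ) (i : Fin (k + 1) → Fin n), L = k + 1 ∧
      StrictMono i ∧ σ (i (Fin.last k)) = x ∧
        ∀ j : Fin k, G.Adj (σ (i j.castSucc)) (σ (i j.succ))} := by
    rintro x
    refine ⟨n, ?_⟩
    rintro L ⟨k, i, rfl, hi, -⟩
    simpa using Fintype.card_le_of_injective i hi.injective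
  -- The one-letter subword shows that the set is nonempty, so its supremum is attained.
  obtain ⟨k, i, hk, hi, hlast, hstep⟩ := Nat.sSup_mem
    (by exact ⟨1, 0, fun _ => a, rfl, Subsingleton.strictMono (α := Fin 1) _, rfl,
      fun j => j.elim0⟩) (hbdd (σ a))
  have hlast' : i (Fin.last k) = a := σ.injective hlast
  change rank G σ (σ a) = k + 1 at hk
  rw [hk]
  refine Nat.lt_of_succ_le (le_csSup (hbdd (σ b))
    ⟨k + 1, Fin.snoc (α := fun _ => Fin n) i b, rfl, ?_, by simp, ?_⟩)
  · refine Fin.strictMono_iff_lt_succ.2 fun j => ?_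
    induction j using Fin.lastCases with
    | last => simpa [hlast'] using hab
    | cast j =>
      rw [Fin.succ_castSucc, Fin.snoc_castSucc, Fin.snoc_castSucc]
      exact hi Fin.castSucc_lt_succ
  · intro j
    induction j using Fin.lastCases with
    | last => simpa [hlast'] using hadj
    | cast j =>
      rw [Fin.succ_castSucc, Fin.snoc_castSucc, Fin.snoc_castSucc]
      exact hstep j

/-- The largest number of vertices of a path in `G` that ends in `x` and along which the colour
strictly decreases. -/
noncomputable def colorRank {n : ℕ} (G : SimpleGraph (Fin n)) (κ : Fin n → ℕ+) (x : Fin n) : ℕ :=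
  sSup {L | ∃ (k : ℕ) (p : Fin (k + 1) → Fin n), L = k + 1 ∧ StrictAnti (κ ∘ p) ∧
    p (Fin.last k) = x ∧ ∀ j : Fin k, G.Adj (p j.castSucc) (p j.succ)}

/-- Both suprema run over the same lengths. Along a subword counted by `rank` the colours decrease
weakly, and strictly because consecutive letters are adjacent. Conversely, strictly decreasing
colours force the vertices of a path to appear in `σ` in the order of the path. -/
theorem rank_eq_colorRank {n : ℕ} {G : SimpleGraph (Fin n)} {κ : Fin n → ℕ+}
    (hκ : ∀ u v, G.Adj u v → κ u ≠ κ v) {σ : Equiv.Perm (Fin n)} (hσ : Antitone (κ ∘ σ)) :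
    rank G σ = colorRank G κ := by
  funext x
  refine congrArg sSup (Set.ext fun L => ⟨?_, ?_⟩)
  · rintro ⟨k, i, hL, hi, hx, hadj⟩
    refine ⟨k, σ ∘ i, hL, Fin.strictAnti_iff_succ_lt.2 fun j => ?_, hx, hadj⟩
    exact lt_of_le_of_ne (hσ (hi Fin.castSucc_lt_succ).le) (hκ _ _ (hadj j)).symm
  · rintro ⟨k, p, hL, hp, hx, hadj⟩
    refine ⟨k, σ.symm ∘ p, hL, fun a b hab => ?_, by simpa using hx, by simpa using hadj⟩
    by_contra hle
    have h := hσ (not_lt.1 hle)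
    simp only [Function.comp_apply, Equiv.apply_symm_apply] at h
    exact absurd (hp hab) (not_lt.2 h)

/-! ### The expansion of the chromatic quasisymmetric function -/

theorem isProper_of_isFWord {n : ℕ} {D : Digraph (Fin n)} {κ : Fin n → ℕ+}
    {σ : Equiv.Perm (Fin n)}
    (h : IsFWord n (DES D.toSimpleGraphInclusive σ)ᶜ (κ ∘ σ)) : IsProper D κ := by
  rw [isFWord_compl_DES_iff] at h
  have key : ∀ a b, a < b → D.toSimpleGraphInclusive.Adj (σ a) (σ b) → κ (σ a) ≠ κ (σ b) := by
    intro a b hab hadj he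
    have hr := rank_lt_rank hab hadj
    rcases sortKey_lt_iff.1 (h hab) with h | ⟨-, h | h⟩
    · exact h.ne he.symm
    · exact lt_asymm h hr
    · exact hr.ne h.1.symm
  intro u v huv
  obtain ⟨a, rfl⟩ := σ.surjective u
  obtain ⟨b, rfl⟩ := σ.surjective v
  rcases lt_trichotomy a b with hab | rfl | hab
  · exact key a b hab huv
  · exact absurd huv (SimpleGraph.irrefl _)
  · exact (key b a hab huv.symm).symm

/-- Sorting by the key built from `colorRank` gives `σ`. Any admissible `τ` has `κ ∘ τ` antitone, so
its rank is `colorRank` too and it sorts the same key. -/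
theorem existsUnique_isFWord {n : ℕ} {D : Digraph (Fin n)} {κ : Fin n → ℕ+}
    (hκ : IsProper D κ) :
    ∃! σ : Equiv.Perm (Fin n), IsFWord n (DES D.toSimpleGraphInclusive σ)ᶜ (κ ∘ σ) := by
  obtain ⟨σ, hσ, huniq⟩ := existsUnique_strictAnti_comp
    (sortKey_injective κ (colorRank D.toSimpleGraphInclusive κ))
  have hanti : Antitone (κ ∘ σ) := fun a b hab =>
    sortKey_le (x := σ b) (y := σ a) (hσ.antitone hab)
  refine ⟨σ, ?_, fun τ hτ => huniq τ ?_⟩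
  · change IsFWord _ _ _
    rwa [isFWord_compl_DES_iff, rank_eq_colorRank hκ hanti]
  · have h := (isFWord_compl_DES_iff _ _ _).1 hτ
    rwa [rank_eq_colorRank hκ hτ.1] at h

/-- Larger colours come earlier in `σ`, and the ends of an edge never tie. -/
theorem asc_eq_inv {n : ℕ} {D : Digraph (Fin n)} {κ : Fin n → ℕ+} (hκ : IsProper D κ)
    {σ : Equiv.Perm (Fin n)} (hσ : Antitone (κ ∘ σ)) : asc D κ = inv D σ := by
  classical
  have hanti : ∀ u v, σ.symm u ≤ σ.symm v → κ v ≤ κ u := fun u v h => by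
    simpa using hσ h
  refine congrArg Finset.card (Finset.filter_congr fun e _ => and_congr_right fun hadj => ?_)
  constructor
  · intro h
    by_contra hle
    exact absurd h (not_lt.2 (hanti _ _ (not_lt.1 hle)))
  · intro h
    -- The underlying simple graph only relates distinct vertices; an inverted pair is distinct
    -- because no letter precedes itself.
    have hne : e.1 ≠ e.2 := fun he => by simp [he] at h
    refine lt_of_le_of_ne (hanti _ _ h.le) (hκ _ _ ?_)
    simp [Digraph.toSimpleGraphInclusive, SimpleGraph.fromRel_adj, hne, hadj]

theorem xMon_comp_equiv {V W : Type*} [Fintype V] [Fintype W] (κ : V → ℕ+) (e : W ≃ V) :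
    xMon (κ ∘ e) = xMon κ :=
  e.sum_comp fun v => Finsupp.single (κ v) 1

theorem sum_withMon_comp_equiv {R : Type*} [CommRing R] {V : Type*} [Fintype V]
    (e : V ≃ V) (m : ℕ+ →₀ ℕ) (f : (V → ℕ+) → R) :
    ∑ κ ∈ withMon m, f (κ ∘ e) = ∑ κ ∈ withMon m, f κ := by
  refine Finset.sum_equiv (e.arrowCongr (Equiv.refl ℕ+)).symm (fun κ => ?_) fun κ _ => rfl
  rw [mem_withMon, mem_withMon, ← xMon_comp_equiv κ e]
  rfl

theorem chromatic_eq_sum_fundamental {n : ℕ} (D : Digraph (Fin n)) :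
    chromatic D = ∑ σ : Equiv.Perm (Fin n), ((Polynomial.X : Polynomial ℚ) ^ inv D σ) •
      fundamental (Polynomial ℚ) n (DES D.toSimpleGraphInclusive σ)ᶜ := by
  classical
  refine Subtype.ext (MvPowerSeries.ext fun m => ?_)
  change _ = MvPowerSeries.coeff m ((QSym (Polynomial ℚ)).subtype _)
  simp only [map_sum, map_smul, Submodule.subtype_apply, chromatic, fundamental,
    coeff_genSeries]
  -- Substituting `w = κ ∘ σ` preserves the monomial, so all summands now range over the same maps
  -- `κ` and the two sums can be exchanged.
  have hσ : ∀ σ : Equiv.Perm (Fin n),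
      ((Polynomial.X : Polynomial ℚ) ^ inv D σ) • ∑ w ∈ withMon m,
          (if IsFWord n (DES D.toSimpleGraphInclusive σ)ᶜ w then (1 : Polynomial ℚ) else 0) =
        ∑ κ ∈ withMon m, if IsFWord n (DES D.toSimpleGraphInclusive σ)ᶜ (κ ∘ σ) then
          (Polynomial.X : Polynomial ℚ) ^ inv D σ else 0 := by
    intro σ
    rw [← sum_withMon_comp_equiv σ, Finset.smul_sum]
    simp
  rw [Finset.sum_congr rfl fun σ _ => hσ σ, Finset.sum_comm]
  refine Finset.sum_congr rfl fun κ _ => ?_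
  split_ifs with hκ
  · obtain ⟨σ, hF, huniq⟩ := existsUnique_isFWord hκ
    rw [Finset.sum_eq_single σ (fun τ _ hne => if_neg fun h => hne (huniq τ h))
      (fun h => absurd (Finset.mem_univ σ) h), if_pos hF, asc_eq_inv hκ hF.1]
  · exact (Finset.sum_eq_zero fun σ _ => if_neg fun h => hκ (isProper_of_isFWord h)).symm

/-- Each summand is a basis vector times a power of `t`, whose coefficients are `0` or `1`. -/
theorem isFPositive_sum {ι : Type*} (s : Finset ι) (a : ι → ℕ) (n : ι → ℕ)
    (S : ∀ i, Finset (Fin (n i - 1))) :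
    IsFPositive (∑ i ∈ s, ((Polynomial.X : Polynomial ℚ) ^ a i) •
      fundamental (Polynomial ℚ) (n i) (S i)) := by
  classical
  intro p k
  simp only [← fundamentalBasis_apply, map_sum, map_smul, Module.Basis.repr_self,
    Finsupp.finsetSum_apply, Polynomial.finsetSum_coeff, Finsupp.smul_apply,
    Finsupp.single_apply, smul_eq_mul, mul_ite, mul_one, mul_zero]
  refine Finset.sum_nonneg fun i _ => ?_
  split_ifs
  · rw [Polynomial.coeff_X_pow]
    split_ifs <;> norm_num
  · simp

end ChromaticQSym

theorem theorem3p1 (n : ℕ) (D : Digraph (Fin n)) (hD : ∀ v, ¬ D.Adj v v) :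
    ChromaticQSym.omega (Polynomial ℚ) (ChromaticQSym.chromatic D) =
        ∑ σ : Equiv.Perm (Fin n), ((Polynomial.X : Polynomial ℚ) ^ ChromaticQSym.inv D σ) •
          ChromaticQSym.fundamental (Polynomial ℚ) n
            (ChromaticQSym.DES D.toSimpleGraphInclusive σ) ∧
      ChromaticQSym.IsFPositive
        (ChromaticQSym.omega (Polynomial ℚ) (ChromaticQSym.chromatic D)) := by
  have h : ChromaticQSym.omega (Polynomial ℚ) (ChromaticQSym.chromatic D) =
      ∑ σ : Equiv.Perm (Fin n), ((Polynomial.X : Polynomial ℚ) ^ ChromaticQSym.inv D σ) •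
        ChromaticQSym.fundamental (Polynomial ℚ) n
          (ChromaticQSym.DES D.toSimpleGraphInclusive σ) := by
    rw [ChromaticQSym.chromatic_eq_sum_fundamental]
    simp only [map_sum, map_smul, ChromaticQSym.omega_fundamental, compl_compl]
  refine ⟨h, ?_⟩
  rw [h]
  exact ChromaticQSym.isFPositive_sum _ _ _ _
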